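/- Let $q$ be a power of a prime, let $G=PGL(2,q)$ act on $\mathbb{P}^1(\overline{\mathbb{F}_q})=\overline{\mathbb{F}_q}\cup\{\infty\}$ by linear fractional transformations $z\mapsto\frac{az+b}{cz+d}$, and on the rational function field $\mathbb{F}_q(x)$ by $r(x)\mapsto r\left(\frac{ax+b}{cx+d}\right)$. Let $\Phi=f/g$, with $f,g\in\mathbb{F}_q[x]$ relatively prime, be a generator of the field $\mathbb{F}_q(x)^G$ of invariant functions (that is, $\mathbb{F}_q(x)^G=\mathbb{F}_q(\Phi)$), normalized so that $\deg f=|G|$ and $\deg g<|G|$. For $\alpha\in\overline{\mathbb{F}_q}$, the value $\Phi(\alpha)$ is taken in $\overline{\mathbb{F}_q}\cup\{\infty\}$. An orbit of $G$ is called regular if it has $|G|$ elements. Let $\gamma\in\mathbb{F}_{q^2}\setminus\mathbb{F}_q$ and $\mu=\Phi(\gamma)$. Then: 1. $\mu\in\mathbb{F}_q$. 2. Let $\lambda\in\mathbb{F}_q$ with $\lambda\neq\mu$. There is $\alpha\in\overline{\mathbb{F}_q}$ with $\Phi(\alpha)=\lambda$. Every such $\alpha$ lies in a regular orbit of $G$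 on $\mathbb{P}^1(\overline{\mathbb{F}_q})$, and there is exactly one $s\in G$ with $s(\alpha)=\alpha^q$. The conjugacy class of $s$ in $G$ does not depend on the choice of $\alpha$; it is called the class determined by $\lambda$. 3. Each conjugacy class of $G$ consisting of elements of order greater than $2$ is determined, in the sense of 2, by exactly one $\lambda\in\mathbb{F}_q\setminus\{\mu\}$. -/

import Mathlib

open scoped MatrixGroups OnePoint

namespace PGLTwo

variable {F K : Type*} [Field F] [Field K] [Algebra F K]

/-- `GL(2, F)` acting on the projective line `K ∪ {∞}` of an extension field `K` of `F` by
`z ↦ (a z + b) / (c z + d)`, as a homomorphism to the permutations of `K ∪ {∞}`. -/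
noncomputable def glToPerm : GL (Fin 2) F →* Equiv.Perm (OnePoint K) :=
  open scoped Classical in
  (MulAction.toPermHom (GL (Fin 2) K) (OnePoint K)).comp
    (Matrix.GeneralLinearGroup.map (algebraMap F K))

theorem glToPerm_comp_scalar :
    (glToPerm (F := F) (K := K)).comp (Matrix.GeneralLinearGroup.scalar (Fin 2)) = 1 := by
  classical
  ext u z
  have hu : algebraMap F K u ≠ 0 := by simp
  induction z using OnePoint.rec with
  | infty => simp [glToPerm, OnePoint.smul_infty_eq_ite]
  | coe z => simp [glToPerm, OnePoint.smul_some_eq_ite]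

/-- The action of `PGL(2, F)` on the projective line `K ∪ {∞}` of an extension field `K` of `F`
by linear fractional transformations. -/
noncomputable instance : MulAction PGL(2, F) (OnePoint K) :=
  MulAction.compHom _ (Matrix.ProjGenLinGroup.lift (glToPerm (F := F) (K := K))
    glToPerm_comp_scalar)

/-- For `r(x) ∈ F(x)` and an invertible matrix `g = (a, b; c, d)`, the rational function
`r((a x + b) / (c x + d))`. -/
noncomputable def mobiusComp (g : GL (Fin 2) F) (r : RatFunc F) : RatFunc F :=
  r.eval RatFunc.C
    ((RatFunc.C (g 0 0) * RatFunc.X + RatFunc.C (g 0 1)) /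
      (RatFunc.C (g 1 0) * RatFunc.X + RatFunc.C (g 1 1)))

/-- `Φ` generates the field `F(x) ^ G` of rational functions invariant under `G = PGL(2, F)`. The
action factors through `PGL(2, F)`, so invariance is tested on all invertible matrices. -/
def IsInvariantGenerator (Φ : RatFunc F) : Prop :=
  (IntermediateField.adjoin F {Φ} : Set (RatFunc F)) =
    {r | ∀ g : GL (Fin 2) F, mobiusComp g r = r}

open scoped Classical in
/-- The value in `K ∪ {∞}` of a rational function `r = f / g` (in lowest terms) at a point `α` of
an extension field `K`; it is `∞` at the zeros of `g`. -/
noncomputable def value (r : RatFunc F) (α : K) : OnePoint K :=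
  if r.denom.aeval α = 0 then ∞ else ((r.num.aeval α / r.denom.aeval α : K) : OnePoint K)

/-- The point `α` of `K` lies in a regular orbit of `PGL(2, F)` on the projective line of `K`: its
orbit has as many elements as the group. -/
def InRegularOrbit (F : Type*) {K : Type*} [Field F] [Field K] [Algebra F K] (α : K) : Prop :=
  Nat.card (MulAction.orbit PGL(2, F) (α : OnePoint K)) = Nat.card PGL(2, F)

/-- The relation between elements `lam` of `F` and conjugacy classes `c` of `PGL(2, F)`: there are
`α` in `K` with `Φ(α) = lam` and `s` in the class `c` with `s(α) = α ^ q`, where `q = |F|`. -/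
def Corresponds (K : Type*) [Field K] [Algebra F K] (Φ : RatFunc F) (lam : F)
    (c : ConjClasses PGL(2, F)) : Prop :=
  ∃ (α : K) (s : PGL(2, F)), value Φ α = ((algebraMap F K lam : K) : OnePoint K) ∧
    s • (α : OnePoint K) = ((α ^ Nat.card F : K) : OnePoint K) ∧ ConjClasses.mk s = c

end PGLTwo

namespace PGLTwo

open Polynomial Matrix.ProjGenLinGroup

/-! ### Möbius action in coordinates -/

section Action

variable {F K : Type*} [Field F] [Field K] [Algebra F K]

/-! Write q = |F| and Φ = f / g. A point fixed by a nontrivial element of PGL(2, F) is rational or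
quadratic over F, so every other point has trivial stabilizer (`smul_injective`). As f - z g has
degree |PGL(2, F)|, a fibre of Φ containing such a point is exactly its orbit
(`exists_smul_eq_of_value_eq`). Rational points are poles of Φ, and the quadratic points form one
orbit, with value μ. The delicate point is that μ is finite: an explicit invariant function vanishes
at quadratic points and has poles at rational ones, so Φ must separate the two
(`value_ne_infty_of_quadratic`).

For λ ≠ μ in F, Frobenius preserves the fibre over λ, so α ^ q = s(α) for a unique s, and replacing
α by r(α) conjugates s by r. Conversely, if t has order greater than 2, a root count gives a regular
α with t(α) = α ^ q (`exists_smul_eq_frob`); then Φ(α) is fixed by Frobenius, hence lies in F. Any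
two such α lie in one orbit, by an argument in the style of Lang's theorem
(`exists_smul_eq_of_smul_eq_frob`), so the class of t determines λ. -/

theorem det_algebraMap_ne_zero (g : GL (Fin 2) F) :
    algebraMap F K (g 0 0) * algebraMap F K (g 1 1) -
      algebraMap F K (g 0 1) * algebraMap F K (g 1 0) ≠ 0 := by
  have h := g.det_ne_zero
  rw [Matrix.det_fin_two] at h
  rw [← map_mul, ← map_mul, ← map_sub]
  exact (_root_.map_ne_zero _).2 h

open scoped Classical in
theorem mk_smul_coe (g : GL (Fin 2) F) (z : K) :
    mk g • (z : OnePoint K) =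
      if algebraMap F K (g 1 0) * z + algebraMap F K (g 1 1) = 0 then ∞
      else (((algebraMap F K (g 0 0) * z + algebraMap F K (g 0 1)) /
        (algebraMap F K (g 1 0) * z + algebraMap F K (g 1 1)) : K) : OnePoint K) := by
  have : mk g • (z : OnePoint K) = glToPerm (F := F) g (z : OnePoint K) := rfl
  rw [this]
  simp only [glToPerm, MonoidHom.comp_apply, MulAction.toPermHom_apply, MulAction.toPerm_apply]
  rw [OnePoint.smul_some_eq_ite]
  simp

theorem mk_smul_coe_eq_coe_iff (g : GL (Fin 2) F) (z w : K) :
    mk g • (z : OnePoint K) = (w : OnePoint K) ↔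
      algebraMap F K (g 0 0) * z + algebraMap F K (g 0 1) =
        w * (algebraMap F K (g 1 0) * z + algebraMap F K (g 1 1)) := by
  classical
  rw [mk_smul_coe]
  split_ifs with h
  · refine ⟨fun h' ↦ (OnePoint.infty_ne_coe _ h').elim, fun h' ↦ ?_⟩
    refine (det_algebraMap_ne_zero (K := K) g ?_).elim
    grind
  · rw [OnePoint.coe_eq_coe, div_eq_iff h]

theorem mk_smul_coe_eq_infty_iff (g : GL (Fin 2) F) (z : K) :
    mk g • (z : OnePoint K) = ∞ ↔
      algebraMap F K (g 1 0) * z + algebraMap F K (g 1 1) = 0 := by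
  classical
  rw [mk_smul_coe]
  split_ifs with h <;> simp [h]

theorem denom_ne_zero_of_mk_smul {g : GL (Fin 2) F} {z w : K}
    (h : mk g • (z : OnePoint K) = (w : OnePoint K)) :
    algebraMap F K (g 1 0) * z + algebraMap F K (g 1 1) ≠ 0 := fun h' ↦ by
  rw [(mk_smul_coe_eq_infty_iff g z).2 h'] at h
  exact OnePoint.infty_ne_coe _ h

theorem mk_eq_one_of_entries {g : GL (Fin 2) F} (h₁ : g 0 1 = 0) (h₂ : g 1 0 = 0)
    (h₃ : g 0 0 = g 1 1) : mk g = 1 := by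
  have h0 : g 0 0 ≠ 0 := by
    have := g.det_ne_zero
    rw [Matrix.det_fin_two] at this
    intro h
    simp [h₁, h₂, h] at this
  have : g = Matrix.GeneralLinearGroup.scalar (Fin 2) (Units.mk0 _ h0) := by
    ext i j
    fin_cases i <;> fin_cases j <;> simp [h₁, h₂, h₃]
  rw [this, mk_scalar]

end Action

/-! ### Frobenius, stabilizers and quadratic points -/

section Frobenius

variable (F : Type*) {K : Type*} [Field F] [Finite F] [Field K] [Algebra F K]

/-- The Frobenius endomorphism `x ↦ x ^ |F|` of an `F`-algebra. -/
noncomputable def frob (K : Type*) [Field K] [Algebra F K] : K →ₐ[F] K :=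
  letI := Fintype.ofFinite F
  FiniteField.frobeniusAlgHom F K

theorem frob_apply (x : K) : frob F K x = x ^ Nat.card F := by
  let := Fintype.ofFinite F
  rw [Nat.card_eq_fintype_card]
  rfl

theorem frob_frob_apply (x : K) : frob F K (frob F K x) = x ^ (Nat.card F ^ 2) := by
  rw [frob_apply, frob_apply, ← pow_mul, sq]

theorem frob_eq_self_iff {x : K} : frob F K x = x ↔ x ∈ Set.range (algebraMap F K) := by
  let := Fintype.ofFinite F
  refine ⟨fun h ↦ ?_, ?_⟩
  · have hne : (X ^ Fintype.card F - X : F[X]) ≠ 0 :=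
      FiniteField.X_pow_card_sub_X_ne_zero F Fintype.one_lt_card
    have hs : (X ^ Fintype.card F - X : F[X]).Splits := by
      rw [splits_iff_card_roots, FiniteField.roots_X_pow_card_sub_X,
        FiniteField.X_pow_card_sub_X_natDegree_eq F Fintype.one_lt_card]
      rfl
    refine hs.mem_range_of_isRoot hne ?_
    rw [frob_apply, Nat.card_eq_fintype_card] at h
    simp [h]
  · rintro ⟨a, rfl⟩
    simp

variable {F}

/-- The matrix entries lie in F, so Frobenius commutes with the action. -/
theorem smul_frob {s : PGL(2, F)} {z w : K} (h : s • (z : OnePoint K) = (w : OnePoint K)) :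
    s • (frob F K z : OnePoint K) = (frob F K w : OnePoint K) := by
  induction s using Matrix.ProjGenLinGroup.induction_on with | mk g =>
  rw [mk_smul_coe_eq_coe_iff] at h ⊢
  simpa using congr(frob F K $h)

/-- A root of a quadratic polynomial over `F` lies in the quadratic extension of `F`. -/
theorem coeff_eq_zero_of_quadratic {z : K} (hz : frob F K (frob F K z) ≠ z) {u v w : F}
    (h : algebraMap F K u * z ^ 2 + algebraMap F K v * z + algebraMap F K w = 0) :
    u = 0 ∧ v = 0 ∧ w = 0 := by
  -- The conjugates z, z^q, z^(q²) are distinct and all satisfy the equation; divided differences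
  -- then kill the coefficients in turn.
  have hz1 : frob F K z ≠ z := fun h ↦ hz (by rw [h, h])
  have h1 : algebraMap F K u * (frob F K z) ^ 2 + algebraMap F K v * frob F K z +
      algebraMap F K w = 0 := by
    simpa using congr(frob F K $h)
  have h2 : algebraMap F K u * (frob F K (frob F K z)) ^ 2 +
      algebraMap F K v * frob F K (frob F K z) + algebraMap F K w = 0 := by
    simpa using congr(frob F K $h1)
  have hz2 : frob F K (frob F K z) ≠ frob F K z := fun h ↦ hz1 ((frob F K).injective h)
  have e1 : algebraMap F K u * (frob F K z + z) + algebraMap F K v = 0 := by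
    apply mul_left_cancel₀ (sub_ne_zero.2 hz1); linear_combination h1 - h
  have e2 : algebraMap F K u * (frob F K (frob F K z) + frob F K z) + algebraMap F K v = 0 := by
    apply mul_left_cancel₀ (sub_ne_zero.2 hz2); linear_combination h2 - h1
  have hu : algebraMap F K u = 0 := by
    apply mul_left_cancel₀ (sub_ne_zero.2 hz); linear_combination e2 - e1
  have hv : algebraMap F K v = 0 := by simpa [hu] using e1
  have hw : algebraMap F K w = 0 := by simpa [hu, hv] using h
  simpa using And.intro hu (And.intro hv hw)

/-- A fixed point of (a, b; c, d) is a root of c z² + (d - a) z - b, whose coefficients must all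
vanish, leaving a scalar matrix. -/
theorem eq_one_of_smul_eq_self {z : K} (hz : frob F K (frob F K z) ≠ z) {s : PGL(2, F)}
    (h : s • (z : OnePoint K) = z) : s = 1 := by
  induction s using Matrix.ProjGenLinGroup.induction_on with | mk g =>
  rw [mk_smul_coe_eq_coe_iff] at h
  obtain ⟨h1, h2, h3⟩ := coeff_eq_zero_of_quadratic hz (u := g 1 0) (v := g 1 1 - g 0 0)
    (w := - g 0 1) (by rw [map_sub, map_neg]; linear_combination -h)
  exact mk_eq_one_of_entries (by simpa using h3) h1 (sub_eq_zero.1 h2).symm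

theorem smul_injective {z : K} (hz : frob F K (frob F K z) ≠ z) :
    Function.Injective fun s : PGL(2, F) ↦ s • (z : OnePoint K) := fun s t h ↦ by
  rw [← inv_mul_eq_one]
  refine eq_one_of_smul_eq_self hz ?_
  rw [mul_smul, inv_smul_eq_iff]
  exact h.symm

theorem exists_smul_eq_coe {z : K} (hz : frob F K (frob F K z) ≠ z) (s : PGL(2, F)) :
    ∃ w : K, s • (z : OnePoint K) = w := by
  induction s using Matrix.ProjGenLinGroup.induction_on with | mk g =>
  suffices h : mk g • (z : OnePoint K) ≠ ∞ by
    obtain ⟨w, hw⟩ := OnePoint.ne_infty_iff_exists.1 h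
    exact ⟨w, hw.symm⟩
  intro h
  rw [mk_smul_coe_eq_infty_iff] at h
  obtain ⟨-, h1, h2⟩ := coeff_eq_zero_of_quadratic hz (u := 0) (by simpa using h)
  exact det_algebraMap_ne_zero (K := K) g (by simp [h1, h2])

theorem inRegularOrbit {z : K} (hz : frob F K (frob F K z) ≠ z) : InRegularOrbit F z :=
  Nat.card_range_of_injective (smul_injective hz)

theorem frob_frob_ne_of_smul {z w : K} (hz : frob F K (frob F K z) ≠ z) {s : PGL(2, F)}
    (h : s • (z : OnePoint K) = w) : frob F K (frob F K w) ≠ w := fun hw ↦ hz <| by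
  have := smul_frob (smul_frob h)
  rw [hw, ← h] at this
  exact OnePoint.coe_injective (MulAction.injective s this)

/-- `PGL(2, F)` is transitive on the elements of the quadratic extension of `F` outside `F`. -/
theorem exists_smul_eq_of_frob_frob {z w : K} (hz : frob F K (frob F K z) = z)
    (hz1 : frob F K z ≠ z) (hw : frob F K (frob F K w) = w) (hw1 : frob F K w ≠ w) :
    ∃ s : PGL(2, F), s • (z : OnePoint K) = w := by
  have hd := sub_ne_zero.2 hz1
  have hd' := sub_ne_zero.2 hw1
  -- An affine map suffices: u and v solve w = u z + v together with its Frobenius conjugate, and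
  -- the solution is Frobenius-invariant.
  obtain ⟨u, hu⟩ := (frob_eq_self_iff F (x := (frob F K w - w) / (frob F K z - z))).1 (by
    rw [map_div₀, map_sub, map_sub, hz, hw, ← neg_sub, ← neg_sub (frob F K z), neg_div_neg_eq])
  rw [eq_div_iff hd] at hu
  obtain ⟨v, hv⟩ := (frob_eq_self_iff F (x := w - algebraMap F K u * z)).1 (by
    simp; linear_combination -hu)
  have hu0 : u ≠ 0 := by rintro rfl; simp at hu; exact hd' hu.symm
  refine ⟨mk (Matrix.GeneralLinearGroup.mkOfDetNeZero !![u, v; 0, 1] (by simpa)), ?_⟩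
  rw [mk_smul_coe_eq_coe_iff]
  simp [Matrix.GeneralLinearGroup.mkOfDetNeZero, hv]

end Frobenius

/-! ### Homogenized polynomials -/

section Homogenization

variable {F A B : Type*} [Field F] [CommRing A] [Algebra F A] [CommRing B] [Algebra F B]

/-- The value at `(u, v)` of the homogenization of degree `n` of the polynomial `p`. -/
noncomputable def homogEval (p : F[X]) (n : ℕ) (u v : A) : A :=
  ∑ i ∈ Finset.range (n + 1), algebraMap F A (p.coeff i) * u ^ i * v ^ (n - i)

theorem map_homogEval (φ : A →ₐ[F] B) (p : F[X]) (n : ℕ) (u v : A) :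
    φ (homogEval p n u v) = homogEval p n (φ u) (φ v) := by
  simp [homogEval]

theorem homogEval_zero_right (p : F[X]) (n : ℕ) (u : A) :
    homogEval p n u 0 = algebraMap F A (p.coeff n) * u ^ n := by
  rw [homogEval, Finset.sum_range_succ, Finset.sum_eq_zero, zero_add, Nat.sub_self, pow_zero,
    mul_one]
  intro i hi
  rw [zero_pow (Nat.sub_ne_zero_of_lt (Finset.mem_range.1 hi)), mul_zero]

theorem homogEval_eq {L : Type*} [Field L] [Algebra F L] {p : F[X]} {n : ℕ}
    (hp : p.natDegree ≤ n) (u : L) {v : L} (hv : v ≠ 0) :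
    homogEval p n u v = v ^ n * aeval (u / v) p := by
  rw [homogEval, aeval_eq_sum_range' (Nat.lt_succ_of_le hp), Finset.mul_sum]
  refine Finset.sum_congr rfl fun i hi ↦ ?_
  rw [Algebra.smul_def, div_pow, ← pow_sub_mul_pow v (Nat.lt_succ_iff.1 (Finset.mem_range.1 hi))]
  field_simp

end Homogenization

/-! ### Invariance of rational functions -/

section RationalFunctions

variable {F : Type*} [Field F]

/-- The rational function `(a x + b) / (c x + d)`. -/
noncomputable def mobius (g : GL (Fin 2) F) : RatFunc F :=
  (RatFunc.C (g 0 0) * RatFunc.X + RatFunc.C (g 0 1)) /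
    (RatFunc.C (g 1 0) * RatFunc.X + RatFunc.C (g 1 1))

theorem mobius_denom_ne_zero (g : GL (Fin 2) F) :
    RatFunc.C (g 1 0) * RatFunc.X + RatFunc.C (g 1 1) ≠ (0 : RatFunc F) := by
  intro h
  have h' : (C (g 1 0) * X + C (g 1 1) : F[X]) = 0 := by
    apply RatFunc.algebraMap_injective F
    simpa using h
  have h0 : g 1 0 = 0 := by simpa using congr(coeff $h' 1)
  have h1 : g 1 1 = 0 := by simpa using congr(coeff $h' 0)
  have := g.det_ne_zero
  rw [Matrix.det_fin_two] at this
  simp [h0, h1] at this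

theorem mobiusComp_eq (g : GL (Fin 2) F) (r : RatFunc F) :
    mobiusComp g r = aeval (mobius g) r.num / aeval (mobius g) r.denom := rfl

theorem IsInvariantGenerator.mobiusComp_eq {Φ : RatFunc F} (hΦ : IsInvariantGenerator Φ)
    (g : GL (Fin 2) F) : mobiusComp g Φ = Φ := by
  have : Φ ∈ (IntermediateField.adjoin F {Φ} : Set (RatFunc F)) :=
    IntermediateField.mem_adjoin_simple_self F Φ
  rw [hΦ] at this
  exact this g

/-- Needed because `mobiusComp` uses lowest terms, whereas the explicit invariant below is an
unreduced fraction. -/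
theorem mobiusComp_div (g : GL (Fin 2) F) (p q : F[X]) (hq : aeval (mobius g) q ≠ 0) :
    mobiusComp g (algebraMap _ _ p / algebraMap _ _ q) =
      aeval (mobius g) p / aeval (mobius g) q := by
  have hq0 : q ≠ 0 := by rintro rfl; simp at hq
  set r : RatFunc F := algebraMap _ _ p / algebraMap _ _ q with hr
  have hd : aeval (mobius g) r.denom ≠ 0 := fun h ↦ hq <| by
    obtain ⟨t, ht⟩ := RatFunc.denom_div_dvd p q
    rw [ht, map_mul, ← hr, h, zero_mul]
  have e : r.num * q = p * r.denom :=
    (RatFunc.num_mul_eq_mul_denom_iff hq0).2 hr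
  rw [mobiusComp_eq, div_eq_div_iff hd hq, ← map_mul, e, map_mul]

theorem algebraMap_homogEval {p q : F[X]} (hq : q ≠ 0) {n : ℕ} {r : F[X]} (hr : r.natDegree ≤ n) :
    algebraMap F[X] (RatFunc F) (homogEval r n p q) =
      algebraMap F[X] (RatFunc F) q ^ n *
        aeval (algebraMap F[X] (RatFunc F) p / algebraMap F[X] (RatFunc F) q) r := by
  rw [← homogEval_eq hr _ (RatFunc.algebraMap_ne_zero hq)]
  exact map_homogEval (IsScalarTower.toAlgHom F F[X] (RatFunc F)) r n p q

/-- Invariance of `Φ` under `g`, as an identity between values of homogenized polynomials. -/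
theorem homogEval_of_mobiusComp_eq {Φ : RatFunc F} (h0 : Φ ≠ 0) {n : ℕ}
    (hn : Φ.num.natDegree ≤ n) (hd : Φ.denom.natDegree ≤ n) {g : GL (Fin 2) F}
    (h : mobiusComp g Φ = Φ) {K : Type*} [Field K] [Algebra F K] (α : K) :
    homogEval Φ.num n (algebraMap F K (g 0 0) * α + algebraMap F K (g 0 1))
        (algebraMap F K (g 1 0) * α + algebraMap F K (g 1 1)) * aeval α Φ.denom =
      aeval α Φ.num * homogEval Φ.denom n (algebraMap F K (g 0 0) * α + algebraMap F K (g 0 1))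
        (algebraMap F K (g 1 0) * α + algebraMap F K (g 1 1)) := by
  set U : F[X] := C (g 0 0) * X + C (g 0 1) with hU
  set V : F[X] := C (g 1 0) * X + C (g 1 1) with hV
  have hV' : algebraMap F[X] (RatFunc F) V ≠ 0 := by
    simpa [hV] using mobius_denom_ne_zero g
  have hV0 : V ≠ 0 := fun h ↦ hV' (by rw [h, map_zero])
  have hM : mobius g = algebraMap F[X] (RatFunc F) U / algebraMap F[X] (RatFunc F) V := by
    simp [mobius, hU, hV]
  rw [mobiusComp_eq, hM] at h
  have hne : aeval (algebraMap F[X] (RatFunc F) U / algebraMap F[X] (RatFunc F) V) Φ.denom ≠ 0 :=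
    fun h' ↦ h0 (by rw [← h, h', div_zero])
  have key : homogEval Φ.num n U V * Φ.denom = Φ.num * homogEval Φ.denom n U V := by
    apply RatFunc.algebraMap_injective F
    rw [map_mul, map_mul, algebraMap_homogEval hV0 hn, algebraMap_homogEval hV0 hd]
    rw [← RatFunc.num_div_denom Φ, RatFunc.num_div_denom Φ, div_eq_iff hne] at h
    have h2 := RatFunc.num_div_denom Φ
    rw [div_eq_iff (RatFunc.algebraMap_ne_zero Φ.denom_ne_zero)] at h2
    rw [h, h2]
    ring
  have := congr(aeval α $key)
  rw [map_mul, map_mul, map_homogEval, map_homogEval] at this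
  simpa [hU, hV] using this

variable [Finite F]

/-- The quotient of `X ^ (q ^ 2) - X` by `X ^ q - X` is a polynomial which does not vanish at `0`. -/
theorem exists_mul_eq_X_pow_sub_X (F : Type*) [Field F] [Finite F] :
    ∃ H : F[X], (X ^ Nat.card F - X) * H = X ^ (Nat.card F ^ 2) - X ∧ H.eval 0 ≠ 0 := by
  -- With q = m + 2, the exponents q - 1 = m + 1 and q² - 1 = (m + 1)(m + 3) involve no subtraction.
  obtain ⟨m, hm⟩ : ∃ m, Nat.card F = m + 2 :=
    ⟨_, (Nat.sub_add_cancel (Nat.succ_le_of_lt Finite.one_lt_card)).symm⟩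
  obtain ⟨H, hH⟩ := sub_dvd_pow_sub_pow (X ^ (m + 1) : F[X]) 1 (m + 3)
  rw [one_pow, ← pow_mul] at hH
  refine ⟨H, ?_, fun h ↦ ?_⟩
  · have e1 : (X ^ (m + 2) - X : F[X]) = X * (X ^ (m + 1) - 1) := by ring
    have e2 : (X ^ ((m + 2) ^ 2) - X : F[X]) = X * (X ^ ((m + 1) * (m + 3)) - 1) := by ring
    rw [hm, e1, e2, hH, mul_assoc]
  · simpa [h] using congr(eval 0 $hH)

/-- Frobenius powers fix a, b, c, d, so this is the difference of one Möbius map at the two points x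
^ (q ^ k) and x, which produces the determinant. -/
theorem aeval_mobius_X_pow_sub_X (g : GL (Fin 2) F) (k : ℕ) :
    aeval (mobius g) (X ^ (Nat.card F ^ k) - X : F[X]) *
      (RatFunc.C (g 1 0) * RatFunc.X + RatFunc.C (g 1 1)) ^ (Nat.card F ^ k + 1) =
      RatFunc.C (g 0 0 * g 1 1 - g 0 1 * g 1 0) * (RatFunc.X ^ (Nat.card F ^ k) - RatFunc.X) := by
  have hfr : ∀ x : RatFunc F, x ^ (Nat.card F ^ k) = ((frob F (RatFunc F)) ^ k) x := fun x ↦ by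
    induction k with
    | zero => simp
    | succ k ih => rw [pow_succ, pow_mul, ih, pow_succ', AlgHom.mul_apply, frob_apply]
  have hC : ∀ a : F, ((frob F (RatFunc F)) ^ k) (RatFunc.C a) = RatFunc.C a :=
    fun a ↦ ((frob F (RatFunc F)) ^ k).commutes a
  have hd := mobius_denom_ne_zero g
  have hw : (RatFunc.C (g 1 0) * RatFunc.X + RatFunc.C (g 1 1)) ^ (Nat.card F ^ k) =
      RatFunc.C (g 1 0) * RatFunc.X ^ (Nat.card F ^ k) + RatFunc.C (g 1 1) := by
    simp only [hfr, map_add, map_mul, hC]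
  have hw' : (RatFunc.C (g 0 0) * RatFunc.X + RatFunc.C (g 0 1)) ^ (Nat.card F ^ k) =
      RatFunc.C (g 0 0) * RatFunc.X ^ (Nat.card F ^ k) + RatFunc.C (g 0 1) := by
    simp only [hfr, map_add, map_mul, hC]
  have hd' := pow_ne_zero (Nat.card F ^ k) hd
  rw [map_sub, map_pow, aeval_X, mobius, div_pow, hw', pow_succ]
  rw [hw] at hd' ⊢
  rw [map_sub, map_mul, map_mul]
  rw [div_sub_div _ _ hd' hd, div_mul_cancel₀ _ (mul_ne_zero hd' hd)]
  ring

/-- The function `(x ^ (q ^ 2) - x) ^ (q + 1) / (x ^ q - x) ^ (q ^ 2 + 1)` is invariant under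
`PGL(2, F)`. -/
theorem mobiusComp_X_pow_sub_X (g : GL (Fin 2) F) :
    mobiusComp g
        (algebraMap F[X] (RatFunc F) ((X ^ (Nat.card F ^ 2) - X) ^ (Nat.card F + 1)) /
          algebraMap F[X] (RatFunc F) ((X ^ Nat.card F - X) ^ (Nat.card F ^ 2 + 1))) =
      algebraMap F[X] (RatFunc F) ((X ^ (Nat.card F ^ 2) - X) ^ (Nat.card F + 1)) /
        algebraMap F[X] (RatFunc F) ((X ^ Nat.card F - X) ^ (Nat.card F ^ 2 + 1)) := by
  let := Fintype.ofFinite F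
  have hq : 1 < Nat.card F := Finite.one_lt_card
  have hX : algebraMap F[X] (RatFunc F) (X ^ Nat.card F - X) ≠ 0 :=
    RatFunc.algebraMap_ne_zero (FiniteField.X_pow_card_sub_X_ne_zero F hq)
  have hw := mobius_denom_ne_zero g
  have hdet : g 0 0 * g 1 1 - g 0 1 * g 1 0 ≠ 0 := by
    have := g.det_ne_zero
    rwa [Matrix.det_fin_two] at this
  have h1 := aeval_mobius_X_pow_sub_X g 1
  have h2 := aeval_mobius_X_pow_sub_X g 2
  rw [pow_one] at h1
  have hD : RatFunc.C (g 0 0 * g 1 1 - g 0 1 * g 1 0) ≠ (0 : RatFunc F) :=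
    (_root_.map_ne_zero _).2 hdet
  have hDq : (RatFunc.C (g 0 0 * g 1 1 - g 0 1 * g 1 0) : RatFunc F) ^ Nat.card F =
      RatFunc.C (g 0 0 * g 1 1 - g 0 1 * g 1 0) := by
    rw [← map_pow, Nat.card_eq_fintype_card, FiniteField.pow_card]
  set D : RatFunc F := RatFunc.C (g 0 0 * g 1 1 - g 0 1 * g 1 0)
  set w : RatFunc F := RatFunc.C (g 1 0) * RatFunc.X + RatFunc.C (g 1 1)
  have hA0 : aeval (mobius g) (X ^ Nat.card F - X : F[X]) ≠ 0 := fun h ↦ by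
    rw [h, zero_mul, eq_comm, mul_eq_zero] at h1
    refine h1.elim hD fun h' ↦ hX ?_
    simpa using h'
  rw [mobiusComp_div _ _ _ (by rw [map_pow]; exact pow_ne_zero _ hA0)]
  simp only [map_pow]
  rw [div_eq_div_iff (pow_ne_zero _ hA0) (pow_ne_zero _ hX)]
  have hX1 : algebraMap F[X] (RatFunc F) (X ^ Nat.card F - X) =
      RatFunc.X ^ Nat.card F - RatFunc.X := by simp
  have hX2 : algebraMap F[X] (RatFunc F) (X ^ (Nat.card F ^ 2) - X) =
      RatFunc.X ^ (Nat.card F ^ 2) - RatFunc.X := by simp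
  rw [← hX1] at h1
  rw [← hX2] at h2
  -- Since D ^ q = D, numerator and denominator acquire the same power of the determinant; both also
  -- acquire w to the power -(q + 1)(q² + 1).
  have hDD : D ^ (Nat.card F ^ 2 + 1) = D ^ (Nat.card F + 1) := by
    rw [pow_succ, pow_succ _ (Nat.card F), sq, pow_mul, hDq, hDq]
  have h1' := congr($h1 ^ (Nat.card F ^ 2 + 1))
  have h2' := congr($h2 ^ (Nat.card F + 1))
  rw [mul_pow, mul_pow, ← pow_mul] at h1' h2'
  rw [mul_comm (Nat.card F ^ 2 + 1)] at h2'
  rw [hDD] at h1'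
  apply mul_left_cancel₀ (pow_ne_zero ((Nat.card F + 1) * (Nat.card F ^ 2 + 1)) hw)
  generalize w ^ ((Nat.card F + 1) * (Nat.card F ^ 2 + 1)) = W at *
  linear_combination (algebraMap F[X] (RatFunc F) (X ^ Nat.card F - X) ^ (Nat.card F ^ 2 + 1)) * h2'
    - (algebraMap F[X] (RatFunc F) (X ^ Nat.card F ^ 2 - X) ^ (Nat.card F + 1)) * h1'

end RationalFunctions

/-! ### Values of an invariant function -/

section Values

variable {F K : Type*} [Field F] [Field K] [Algebra F K]

theorem aeval_num_ne_zero_of_denom {Φ : RatFunc F} {α : K} (h : aeval α Φ.denom = 0) :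
    aeval α Φ.num ≠ 0 := fun h' ↦ by
  obtain ⟨u, v, huv⟩ := RatFunc.isCoprime_num_denom Φ
  simpa [h, h'] using congr(aeval α $huv)

theorem value_eq_infty_iff {Φ : RatFunc F} {α : K} :
    value Φ α = ∞ ↔ aeval α Φ.denom = 0 := by
  rw [value]
  split_ifs with h <;> simp [h]

theorem value_eq_coe_iff {Φ : RatFunc F} {α z : K} :
    value Φ α = (z : OnePoint K) ↔ aeval α Φ.num = z * aeval α Φ.denom := by
  rw [value]
  split_ifs with h
  · simpa [h] using aeval_num_ne_zero_of_denom h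
  · rw [OnePoint.coe_eq_coe, div_eq_iff h]

/-- The homogenized identity gives f(β) g(α) = f(α) g(β), which also covers poles because f and g
have no common zero. -/
theorem value_smul {Φ : RatFunc F} (h0 : Φ ≠ 0) (hinv : ∀ g, mobiusComp g Φ = Φ)
    {s : PGL(2, F)} {α β : K} (h : s • (α : OnePoint K) = β) : value Φ β = value Φ α := by
  induction s using Matrix.ProjGenLinGroup.induction_on with | mk g =>
  have hV := denom_ne_zero_of_mk_smul h
  rw [mk_smul_coe_eq_coe_iff, ← div_eq_iff hV] at h
  have key := homogEval_of_mobiusComp_eq h0 (le_max_left _ Φ.denom.natDegree) (le_max_right _ _)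
    (hinv g) α
  rw [homogEval_eq (le_max_left _ _) _ hV, homogEval_eq (le_max_right _ _) _ hV, h] at key
  have key' : aeval β Φ.num * aeval α Φ.denom = aeval α Φ.num * aeval β Φ.denom := by
    apply mul_left_cancel₀ (pow_ne_zero (max Φ.num.natDegree Φ.denom.natDegree) hV)
    linear_combination key
  by_cases hα : aeval α Φ.denom = 0
  · rw [value_eq_infty_iff.2 hα, value_eq_infty_iff]
    simpa [hα, aeval_num_ne_zero_of_denom hα] using key'
  · have hv : value Φ α = ((aeval α Φ.num / aeval α Φ.denom : K) : OnePoint K) := by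
      rw [value_eq_coe_iff, div_mul_cancel₀ _ hα]
    rw [hv, value_eq_coe_iff, div_mul_eq_mul_div, eq_div_iff hα, key']

/-- Φ has a pole at ∞ by the degree condition, and the chosen matrix moves a to ∞; there
homogenization retains only the coefficients of degree deg f. -/
theorem value_algebraMap {Φ : RatFunc F} (h0 : Φ ≠ 0) (hinv : ∀ g, mobiusComp g Φ = Φ)
    (hdeg : Φ.denom.natDegree < Φ.num.natDegree) (a : F) : value Φ (algebraMap F K a) = ∞ := by
  rw [value_eq_infty_iff]
  have key := homogEval_of_mobiusComp_eq h0 le_rfl hdeg.le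
    (hinv (Matrix.GeneralLinearGroup.mkOfDetNeZero !![0, 1; 1, -a] (by simp)))
    (algebraMap F K a)
  simpa [Matrix.GeneralLinearGroup.mkOfDetNeZero, homogEval_zero_right,
    coeff_eq_zero_of_natDegree_lt hdeg, h0] using key

theorem natDegree_fibre {p q : F[X]} (h : q.natDegree < p.natDegree) (z : K) :
    (p.map (algebraMap F K) - C z * q.map (algebraMap F K)).natDegree = p.natDegree := by
  rw [natDegree_sub_eq_left_of_natDegree_lt, natDegree_map]
  rw [natDegree_map]
  refine (natDegree_C_mul_le _ _).trans_lt ?_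
  rwa [natDegree_map]

theorem isRoot_fibre_iff {Φ : RatFunc F} {z w : K} :
    (Φ.num.map (algebraMap F K) - C z * Φ.denom.map (algebraMap F K)).IsRoot w ↔
      value Φ w = (z : OnePoint K) := by
  rw [value_eq_coe_iff, IsRoot, eval_sub, eval_mul, eval_C, eval_map_algebraMap,
    eval_map_algebraMap, sub_eq_zero]

theorem value_frob [Finite F] {Φ : RatFunc F} {α z : K} (h : value Φ α = (z : OnePoint K)) :
    value Φ (frob F K α) = (frob F K z : OnePoint K) := by
  rw [value_eq_coe_iff] at h ⊢
  rw [aeval_algHom_apply, aeval_algHom_apply, h, map_mul]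

end Values

/-! ### Fibres and regular orbits -/

section Fibres

variable {F K : Type*} [Field F] [Finite F] [Field K] [Algebra F K]

instance : Finite PGL(2, F) := Finite.of_surjective _ mk_surjective

/-- A polynomial vanishing on a regular orbit has degree at least `|PGL(2, F)|`, and in case of
equality it has no other roots. -/
theorem card_le_natDegree_of_orbit {p : K[X]} (hp : p ≠ 0) {α : K}
    (hα : frob F K (frob F K α) ≠ α)
    (h : ∀ (s : PGL(2, F)) (w : K), s • (α : OnePoint K) = w → p.IsRoot w) :
    Nat.card PGL(2, F) ≤ p.natDegree ∧ (p.natDegree = Nat.card PGL(2, F) →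
      ∀ β, p.IsRoot β → ∃ s : PGL(2, F), s • (α : OnePoint K) = β) := by
  classical
  let := Fintype.ofFinite PGL(2, F)
  choose f hf using fun s : PGL(2, F) ↦ exists_smul_eq_coe hα s
  have hinj : Function.Injective f := fun s t hst ↦ smul_injective hα <| by
    simp only [hf, hst]
  have hsub : Finset.univ.image f ⊆ p.roots.toFinset := fun w hw ↦ by
    obtain ⟨s, -, rfl⟩ := Finset.mem_image.1 hw
    simpa [hp] using h s _ (hf s)
  have hcard : (Finset.univ.image f).card = Nat.card PGL(2, F) := by
    rw [Finset.card_image_of_injective _ hinj, Finset.card_univ, Nat.card_eq_fintype_card]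
  have hle : p.roots.toFinset.card ≤ p.natDegree :=
    (Multiset.toFinset_card_le _).trans (card_roots' p)
  refine ⟨hcard ▸ (Finset.card_le_card hsub).trans hle, fun hd β hβ ↦ ?_⟩
  have heq := Finset.eq_of_subset_of_card_le hsub (by rw [hcard, ← hd]; exact hle)
  have : β ∈ Finset.univ.image f := by
    rw [heq]
    simpa [hp] using hβ
  obtain ⟨s, -, rfl⟩ := Finset.mem_image.1 this
  exact ⟨s, hf s⟩

theorem ne_zero_of_natDegree_num {Φ : RatFunc F}
    (hnum : Φ.num.natDegree = Nat.card PGL(2, F)) : Φ ≠ 0 := by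
  rintro rfl
  rw [RatFunc.num_zero, natDegree_zero] at hnum
  exact Nat.card_pos.ne hnum

/-- The |PGL(2, F)| points of the orbit of α exhaust the roots of f - z g. -/
theorem exists_smul_eq_of_value_eq {Φ : RatFunc F} (hinv : ∀ g, mobiusComp g Φ = Φ)
    (hnum : Φ.num.natDegree = Nat.card PGL(2, F))
    (hdenom : Φ.denom.natDegree < Nat.card PGL(2, F)) {α β : K} (hα : frob F K (frob F K α) ≠ α) {z : K}
    (h : value Φ α = (z : OnePoint K)) (h' : value Φ β = (z : OnePoint K)) :
    ∃ s : PGL(2, F), s • (α : OnePoint K) = β := by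
  have hd := natDegree_fibre (hnum ▸ hdenom) z
  refine (card_le_natDegree_of_orbit ?_ hα fun s w hw ↦ ?_).2 (hd.trans hnum) β
    (isRoot_fibre_iff.2 h')
  · rintro h0
    rw [h0, natDegree_zero, hnum] at hd
    exact Nat.card_pos.ne hd
  · rw [isRoot_fibre_iff, value_smul (ne_zero_of_natDegree_num hnum) hinv hw, h]

/-- The denominator has too small a degree to vanish on a regular orbit. -/
theorem value_ne_infty {Φ : RatFunc F} (hinv : ∀ g, mobiusComp g Φ = Φ)
    (hnum : Φ.num.natDegree = Nat.card PGL(2, F))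
    (hdenom : Φ.denom.natDegree < Nat.card PGL(2, F)) {α : K} (hα : frob F K (frob F K α) ≠ α) : value Φ α ≠ ∞ := fun h ↦ by
  refine hdenom.not_ge ?_
  rw [← natDegree_map (algebraMap F K) (p := Φ.denom)]
  refine (card_le_natDegree_of_orbit
    ((Polynomial.map_ne_zero_iff (algebraMap F K).injective).2 Φ.denom_ne_zero) hα
    fun s w hw ↦ ?_).1
  rw [IsRoot, eval_map_algebraMap, ← value_eq_infty_iff,
    value_smul (ne_zero_of_natDegree_num hnum) hinv hw, h]

theorem exists_value_eq [IsAlgClosed K] {Φ : RatFunc F}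
    (hnum : Φ.num.natDegree = Nat.card PGL(2, F))
    (hdenom : Φ.denom.natDegree < Nat.card PGL(2, F)) (z : K) :
    ∃ α : K, value Φ α = (z : OnePoint K) := by
  have hd := natDegree_fibre (hnum ▸ hdenom) z
  obtain ⟨α, hα⟩ := IsAlgClosed.exists_root
    (Φ.num.map (algebraMap F K) - C z * Φ.denom.map (algebraMap F K)) fun h0 ↦ by
      rw [natDegree_eq_of_degree_eq_some (n := 0) h0, hnum] at hd
      exact Nat.card_pos.ne hd
  exact ⟨α, isRoot_fibre_iff.1 hα⟩

/-- A generator of the field of invariants has no pole at the elements of the quadratic extension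
outside `F`. -/
theorem value_ne_infty_of_quadratic {Φ : RatFunc F}
    (hnum : Φ.num.natDegree = Nat.card PGL(2, F))
    (hdenom : Φ.denom.natDegree < Nat.card PGL(2, F)) (hΦ : IsInvariantGenerator Φ) {γ : K}
    (hγ : frob F K (frob F K γ) = γ) (hγ1 : frob F K γ ≠ γ) : value Φ γ ≠ ∞ := fun hval ↦ by
  have hinv := hΦ.mobiusComp_eq
  have h0 := ne_zero_of_natDegree_num hnum
  have hq : 1 < Nat.card F := Finite.one_lt_card
  have hmem : algebraMap F[X] (RatFunc F) ((X ^ (Nat.card F ^ 2) - X) ^ (Nat.card F + 1)) /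
      algebraMap F[X] (RatFunc F) ((X ^ Nat.card F - X) ^ (Nat.card F ^ 2 + 1)) ∈
      (IntermediateField.adjoin F {Φ} : Set (RatFunc F)) := by
    rw [hΦ]
    exact mobiusComp_X_pow_sub_X
  rw [SetLike.mem_coe, IntermediateField.mem_adjoin_simple_iff] at hmem
  obtain ⟨r, s, hrs⟩ := hmem
  have hA : (X ^ Nat.card F - X : F[X]) ≠ 0 := FiniteField.X_pow_card_sub_X_ne_zero F hq
  have hB : (X ^ (Nat.card F ^ 2) - X : F[X]) ≠ 0 :=
    FiniteField.X_pow_card_pow_sub_X_ne_zero F two_ne_zero hq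
  have hA' := RatFunc.algebraMap_ne_zero (pow_ne_zero (Nat.card F ^ 2 + 1) hA)
  have hs : aeval Φ s ≠ 0 := fun h ↦ by
    rw [h, div_zero, div_eq_zero_iff] at hrs
    exact hrs.elim (RatFunc.algebraMap_ne_zero (pow_ne_zero _ hB)) hA'
  rw [div_eq_div_iff hA' hs] at hrs
  set N := max r.natDegree s.natDegree
  obtain ⟨H, hH, hH0⟩ := exists_mul_eq_X_pow_sub_X F
  -- The invariant equals r(Φ) / s(Φ). Clear denominators and cancel (X^q - X)^(q + 1), so that H
  -- still vanishes at γ while the remaining power of X^q - X vanishes at 0.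
  have key : H ^ (Nat.card F + 1) * homogEval s N Φ.num Φ.denom =
      homogEval r N Φ.num Φ.denom * (X ^ Nat.card F - X) ^ (Nat.card F * (Nat.card F - 1)) := by
    apply mul_left_cancel₀ (pow_ne_zero (Nat.card F + 1) hA)
    have e : Nat.card F ^ 2 + 1 = Nat.card F * (Nat.card F - 1) + (Nat.card F + 1) := by
      obtain ⟨m, hm⟩ := Nat.exists_eq_add_of_lt hq
      rw [hm]
      simp
      ring
    rw [← mul_assoc, ← mul_pow, hH, mul_left_comm, ← pow_add, add_comm (Nat.card F + 1), ← e]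
    apply RatFunc.algebraMap_injective F
    rw [map_mul, map_mul, algebraMap_homogEval Φ.denom_ne_zero (le_max_left _ _),
      algebraMap_homogEval Φ.denom_ne_zero (le_max_right _ _), RatFunc.num_div_denom]
    linear_combination (algebraMap F[X] (RatFunc F) Φ.denom) ^ N * hrs
  -- If γ and 0 are both poles of Φ, evaluating `key` at γ kills the top coefficient of r, and at 0
  -- that of s. As N is the larger degree, r or s would be zero.
  have hr0 : r.coeff N = 0 := by
    have hden := value_eq_infty_iff.1 hval
    have hHγ : aeval γ H = 0 := by
      have := congr(aeval γ $hH)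
      rw [map_mul, map_sub, map_sub, map_pow, map_pow, aeval_X, ← frob_apply, ← frob_frob_apply,
        hγ, sub_self] at this
      exact (mul_eq_zero.1 this).resolve_left (sub_ne_zero.2 hγ1)
    have := congr(aeval γ $key)
    rw [map_mul, map_mul, map_homogEval, map_homogEval, hden, homogEval_zero_right,
      homogEval_zero_right, map_pow, hHγ, zero_pow (Nat.succ_ne_zero _), zero_mul, map_pow, map_sub,
      map_pow, aeval_X, ← frob_apply, eq_comm, mul_eq_zero, mul_eq_zero] at this
    simpa using (this.resolve_right (pow_ne_zero _ (sub_ne_zero.2 hγ1))).resolve_right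
      (pow_ne_zero _ (aeval_num_ne_zero_of_denom hden))
  have hs0 : s.coeff N = 0 := by
    have hden := value_eq_infty_iff.1 (value_algebraMap (K := F) h0 hinv (hnum ▸ hdenom) 0)
    rw [map_zero] at hden
    have := congr(aeval (0 : F) $key)
    rw [map_mul, map_mul, map_homogEval, map_homogEval, hden, homogEval_zero_right,
      homogEval_zero_right, map_pow, map_pow, map_sub, map_pow, aeval_X,
      zero_pow (zero_lt_one.trans hq).ne', sub_zero,
      zero_pow (Nat.mul_pos (zero_lt_one.trans hq) (Nat.sub_pos_of_lt hq)).ne', mul_zero,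
      mul_eq_zero, mul_eq_zero] at this
    rw [← coe_aeval_eq_eval] at hH0
    simpa using (this.resolve_left (pow_ne_zero _ hH0)).resolve_right
      (pow_ne_zero _ (aeval_num_ne_zero_of_denom hden))
  rcases max_choice r.natDegree s.natDegree with h | h
  · rw [show N = r.natDegree from h, coeff_natDegree, leadingCoeff_eq_zero] at hr0
    rw [hr0, map_zero, zero_mul, mul_eq_zero] at hrs
    exact hrs.elim (RatFunc.algebraMap_ne_zero (pow_ne_zero _ hB)) hs
  · rw [show N = s.natDegree from h, coeff_natDegree, leadingCoeff_eq_zero] at hs0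
    exact hs (by rw [hs0, map_zero])

end Fibres

/-! ### Solutions of s(α) = α ^ q -/

theorem natDegree_quadratic_lt {F : Type*} [Field F] {a b c d u v w : F} {q : ℕ}
    (hq : 2 ≤ q) (hdet : a * d - b * c ≠ 0)
    (hu : c = 0 → u = 0) :
    (C u * X ^ 2 + C v * X + C w : F[X]).natDegree <
      (C c * X ^ (q + 1) + C d * X ^ q - C a * X - C b : F[X]).natDegree := by
  -- For c = 0 the right side has degree only q, possibly 2, so the vanishing of u is needed for
  -- strictness.
  by_cases hc : c = 0
  · have hd : d ≠ 0 := by rintro rfl; simp [hc] at hdet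
    have e1 : (C u * X ^ 2 + C v * X + C w : F[X]).natDegree ≤ 1 := by
      rw [hu hc, C_0, zero_mul, zero_add]
      compute_degree
    refine e1.trans_lt (hq.trans (le_natDegree_of_ne_zero ?_))
    have h1 : q ≠ 1 := by lia
    have h0 : q ≠ 0 := by lia
    simpa [hc, coeff_X, coeff_C, h0, h1.symm] using hd
  · have e1 : (C u * X ^ 2 + C v * X + C w : F[X]).natDegree ≤ 2 := by compute_degree
    refine e1.trans_lt ((Nat.succ_le_succ hq).trans (le_natDegree_of_ne_zero ?_))
    have h0 : q ≠ 0 := by lia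
    simpa [coeff_X, coeff_C, coeff_X_pow, h0] using hc

section Lang

variable {F K : Type*} [Field F] [Finite F] [Field K] [Algebra F K]

/-- The points which an element of `PGL(2, F)` maps to their Frobenius conjugates, and which are
not rational over `F`, form a single orbit of `PGL(2, F)`. -/
theorem exists_smul_eq_of_smul_eq_frob {s : PGL(2, F)} {α β : K} (hα : frob F K α ≠ α)
    (hβ : frob F K β ≠ β) (hs : s • (α : OnePoint K) = (frob F K α : OnePoint K))
    (hs' : s • (β : OnePoint K) = (frob F K β : OnePoint K)) :
    ∃ t : PGL(2, F), t • (α : OnePoint K) = β := by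
  by_cases hαβ : frob F K α = β
  · exact ⟨s, by rw [hs, hαβ]⟩
  induction s using Matrix.ProjGenLinGroup.induction_on with | mk g =>
  have hk := denom_ne_zero_of_mk_smul hs
  have hk' := denom_ne_zero_of_mk_smul hs'
  rw [mk_smul_coe_eq_coe_iff] at hs hs'
  have hfα : algebraMap F K (g 0 0) * frob F K α + algebraMap F K (g 0 1) =
      frob F K (frob F K α) *
        (algebraMap F K (g 1 0) * frob F K α + algebraMap F K (g 1 1)) := by
    simpa using congr(frob F K $hs)
  set k := algebraMap F K (g 1 0) * α + algebraMap F K (g 1 1) with hkdef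
  set k' := algebraMap F K (g 1 0) * β + algebraMap F K (g 1 1) with hkdef'
  have hkf : frob F K k ≠ 0 := (_root_.map_ne_zero _).2 hk
  have hkf' : frob F K k = algebraMap F K (g 1 0) * frob F K α + algebraMap F K (g 1 1) := by
    simp [hkdef]
  rw [← hkf'] at hfα
  have h1 : frob F K α - β ≠ 0 := sub_ne_zero.2 hαβ
  have h2 : frob F K (frob F K α) - frob F K β ≠ 0 := by
    rw [← map_sub]
    exact (_root_.map_ne_zero _).2 h1
  -- The required element is 1 + ρ g, which commutes with g; ρ is found by solving (1 + ρ g)(α) = β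
  -- using g(α) = α^q.
  obtain ⟨ρ, hρ⟩ := (frob_eq_self_iff F (x := (β - α) / (k * (frob F K α - β)))).1 (by
    rw [map_div₀, map_mul, map_sub, map_sub,
      div_eq_div_iff (mul_ne_zero hkf h2) (mul_ne_zero hk h1)]
    -- Invariance of ρ comes from the formula for a difference of Möbius values, applied to the
    -- pairs β, α and α^q, β; the common determinant is eliminated.
    have e : ((algebraMap F K (g 0 0) * β + algebraMap F K (g 0 1)) * k -
        (algebraMap F K (g 0 0) * α + algebraMap F K (g 0 1)) * k') * (frob F K α - β) =
        (β - α) * (k' * (algebraMap F K (g 0 0) * frob F K α + algebraMap F K (g 0 1)) -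
          frob F K k * (algebraMap F K (g 0 0) * β + algebraMap F K (g 0 1))) := by
      rw [hkf', hkdef, hkdef']
      ring
    apply mul_left_cancel₀ hk'
    linear_combination e - k * (frob F K α - β) * hs' + k' * (frob F K α - β) * hs +
      (β - α) * k' * hfα - (β - α) * frob F K k * hs')
  rw [eq_div_iff (mul_ne_zero hk h1)] at hρ
  have hw : algebraMap F K (ρ * g 1 0) * α + algebraMap F K (1 + ρ * g 1 1) ≠ 0 := fun h ↦ by
    apply sub_ne_zero.2 hα
    simp only [map_mul, map_add, map_one] at h
    linear_combination (frob F K α - β) * h - hρ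
  have hval : algebraMap F K (1 + ρ * g 0 0) * α + algebraMap F K (ρ * g 0 1) =
      β * (algebraMap F K (ρ * g 1 0) * α + algebraMap F K (1 + ρ * g 1 1)) := by
    simp only [map_mul, map_add, map_one]
    linear_combination algebraMap F K ρ * hs + hρ
  -- A singular matrix would have first row β times the second; as the entries are in F and β is
  -- not, the second row would vanish, contrary to `hw`.
  have hdet : (1 + ρ * g 0 0) * (1 + ρ * g 1 1) - ρ * g 0 1 * (ρ * g 1 0) ≠ 0 := fun h ↦ by
    have hd := congr(algebraMap F K $h)
    rw [map_sub, map_mul, map_mul, map_zero] at hd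
    have e1 : β * algebraMap F K (ρ * g 1 0) = algebraMap F K (1 + ρ * g 0 0) := by
      apply mul_right_cancel₀ hw
      linear_combination (-algebraMap F K (ρ * g 1 0)) * hval - hd
    have e2 : β * algebraMap F K (1 + ρ * g 1 1) = algebraMap F K (ρ * g 0 1) := by
      apply mul_right_cancel₀ hw
      linear_combination (-algebraMap F K (1 + ρ * g 1 1)) * hval + α * hd
    have f1 := congr(frob F K $e1)
    have f2 := congr(frob F K $e2)
    rw [map_mul, AlgHom.commutes, AlgHom.commutes] at f1 f2
    apply hw
    apply mul_left_cancel₀ (sub_ne_zero.2 hβ)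
    linear_combination α * (f1 - e1) + (f2 - e2)
  refine ⟨mk (Matrix.GeneralLinearGroup.mkOfDetNeZero
    !![1 + ρ * g 0 0, ρ * g 0 1; ρ * g 1 0, 1 + ρ * g 1 1] (by simpa using hdet)), ?_⟩
  rw [mk_smul_coe_eq_coe_iff]
  simpa [Matrix.GeneralLinearGroup.mkOfDetNeZero] using hval

/-- The derivative is c X^q - a, and c p - (c X + d) p' = ad - bc is a Bézout identity. -/
theorem separable_frob_graph {a b c d : K} (hdet : a * d - b * c ≠ 0) :
    (C c * X ^ (Nat.card F + 1) + C d * X ^ Nat.card F - C a * X - C b : K[X]).Separable := by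
  let := Fintype.ofFinite F
  have hq : (Nat.card F : K) = 0 := by
    rw [Nat.card_eq_fintype_card, ← map_natCast (algebraMap F K), FiniteField.cast_card_eq_zero,
      map_zero]
  rw [separable_def]
  have hder : derivative (C c * X ^ (Nat.card F + 1) + C d * X ^ Nat.card F - C a * X - C b : K[X])
      = C c * X ^ Nat.card F - C a := by
    simp only [derivative_sub, derivative_C_mul, derivative_X_pow, derivative_X,
      derivative_C, Nat.cast_add, Nat.cast_one, hq, C_0, C_1, zero_add, zero_mul, mul_zero,
      add_zero, sub_zero, mul_one, one_mul, map_add, Nat.add_sub_cancel]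
  rw [hder]
  refine ⟨C (a * d - b * c)⁻¹ * C c, - C (a * d - b * c)⁻¹ * (C c * X + C d), ?_⟩
  have : (C (a * d - b * c)⁻¹ * C (a * d - b * c) : K[X]) = 1 := by
    rw [← C_mul, inv_mul_cancel₀ hdet, C_1]
  rw [C_sub, C_mul, C_mul] at this
  linear_combination this

/-- The solutions of t(α) = α^q are the roots of the separable polynomial p. Those fixed by the
square of Frobenius are fixed by t² ≠ 1, hence are roots of a nonzero Q of smaller degree, so some
root of p escapes. -/
theorem exists_smul_eq_frob [IsAlgClosed K] {t : PGL(2, F)} (ht : t * t ≠ 1) :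
    ∃ α : K, frob F K (frob F K α) ≠ α ∧ t • (α : OnePoint K) = (frob F K α : OnePoint K) := by
  induction t using Matrix.ProjGenLinGroup.induction_on with | mk g =>
  have hdet := det_algebraMap_ne_zero (K := K) g
  set h := g * g with hh
  set p : K[X] := C (algebraMap F K (g 1 0)) * X ^ (Nat.card F + 1) +
    C (algebraMap F K (g 1 1)) * X ^ Nat.card F - C (algebraMap F K (g 0 0)) * X -
    C (algebraMap F K (g 0 1)) with hp
  set Q : K[X] := C (algebraMap F K (h 1 0)) * X ^ 2 + C (algebraMap F K (h 1 1 - h 0 0)) * X +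
    C (algebraMap F K (- h 0 1)) with hQ
  have hQ0 : Q ≠ 0 := fun h0 ↦ ht <| by
    have h2 : algebraMap F K (h 1 0) = 0 := by simpa [hQ, coeff_X, coeff_C] using congr(coeff $h0 2)
    have h1 : algebraMap F K (h 1 1 - h 0 0) = 0 := by
      simpa only [hQ, coeff_add, coeff_C_mul, coeff_X_pow, coeff_X_one, coeff_C, coeff_zero,
        OfNat.one_ne_ofNat, one_ne_zero, if_false, mul_zero, mul_one, zero_add, add_zero]
        using congr(coeff $h0 1)
    have h3 : algebraMap F K (- h 0 1) = 0 := by simpa [hQ] using congr(coeff $h0 0)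
    rw [_root_.map_eq_zero] at h1 h2 h3
    rw [← map_mul]
    exact mk_eq_one_of_entries (neg_eq_zero.1 h3) h2 (sub_eq_zero.1 h1).symm
  have hlt : Q.natDegree < p.natDegree := natDegree_quadratic_lt Finite.one_lt_card hdet fun hc ↦ by
    rw [_root_.map_eq_zero] at hc
    simp [hh, Matrix.mul_apply, Fin.sum_univ_two, hc]
  obtain ⟨α, hα, hαQ⟩ : ∃ α, p.IsRoot α ∧ ¬ Q.IsRoot α := by
    by_contra! hcon
    have hp0 : p ≠ 0 := by rintro h0; simp [h0] at hlt
    have hle : p.roots ≤ Q.roots :=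
      (Multiset.le_iff_subset (nodup_roots (separable_frob_graph (F := F) hdet))).2 fun α hα ↦
        (mem_roots hQ0).2 (hcon α ((mem_roots hp0).1 hα))
    refine hlt.not_ge ?_
    rw [← splits_iff_card_roots.1 (IsAlgClosed.splits p)]
    exact (Multiset.card_le_card hle).trans (card_roots' Q)
  have hgα : mk g • (α : OnePoint K) = (frob F K α : OnePoint K) := by
    rw [mk_smul_coe_eq_coe_iff, frob_apply]
    simp [hp] at hα
    linear_combination -hα
  refine ⟨α, fun hfix ↦ hαQ ?_, hgα⟩
  have h2 : mk h • (α : OnePoint K) = α := by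
    rw [hh, map_mul, mul_smul, hgα, smul_frob hgα, hfix]
  rw [mk_smul_coe_eq_coe_iff] at h2
  simp [hQ]
  linear_combination -h2

end Lang

end PGLTwo

/-! ### The main theorem -/

theorem theorem7p8 {F K : Type*} [Field F] [Finite F] [Field K] [Algebra F K] [IsAlgClosure F K]
    (Φ : RatFunc F) (hΦ : PGLTwo.IsInvariantGenerator Φ)
    (hnum : Φ.num.natDegree = Nat.card PGL(2, F))
    (hdenom : Φ.denom.natDegree < Nat.card PGL(2, F))
    (γ : K) (hγ : γ ^ (Nat.card F ^ 2) = γ) (hγF : γ ∉ Set.range (algebraMap F K)) :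
    ∃ mu : F, PGLTwo.value Φ γ = ((algebraMap F K mu : K) : OnePoint K) ∧
      (∀ lam : F, lam ≠ mu →
        (∃ α : K, PGLTwo.value Φ α = ((algebraMap F K lam : K) : OnePoint K)) ∧
        (∀ α : K, PGLTwo.value Φ α = ((algebraMap F K lam : K) : OnePoint K) →
          PGLTwo.InRegularOrbit F α ∧
          ∃! s : PGL(2, F), s • (α : OnePoint K) = ((α ^ Nat.card F : K) : OnePoint K)) ∧
        ∃! c : ConjClasses PGL(2, F), PGLTwo.Corresponds K Φ lam c) ∧
      ∀ t : PGL(2, F), 2 < orderOf t →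
        ∃! lam : F, lam ≠ mu ∧ PGLTwo.Corresponds K Φ lam (ConjClasses.mk t) := by
  have : IsAlgClosed K := IsAlgClosure.isAlgClosed F
  have hinv := hΦ.mobiusComp_eq
  have h0 := PGLTwo.ne_zero_of_natDegree_num hnum
  have hdeg : Φ.denom.natDegree < Φ.num.natDegree := hnum ▸ hdenom
  rw [← PGLTwo.frob_frob_apply] at hγ
  rw [← PGLTwo.frob_eq_self_iff] at hγF
  obtain ⟨z, hz⟩ := OnePoint.ne_infty_iff_exists.1
    (PGLTwo.value_ne_infty_of_quadratic hnum hdenom hΦ hγ hγF)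
  have hquad : ∀ α : K, PGLTwo.frob F K (PGLTwo.frob F K α) = α → PGLTwo.frob F K α ≠ α →
      PGLTwo.value Φ α = z :=
    fun α hα hα1 ↦ by
      obtain ⟨s, hs⟩ := PGLTwo.exists_smul_eq_of_frob_frob hγ hγF hα hα1
      rw [PGLTwo.value_smul h0 hinv hs, hz]
  obtain ⟨mu, rfl⟩ : z ∈ Set.range (algebraMap F K) := by
    rw [← PGLTwo.frob_eq_self_iff]
    refine OnePoint.coe_injective ?_
    rw [← PGLTwo.value_frob hz.symm]
    exact hquad _ (congrArg _ hγ) fun h ↦ hγF ((PGLTwo.frob F K).injective h)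
  have hreg : ∀ (lam : F) (α : K), lam ≠ mu →
      PGLTwo.value Φ α = ((algebraMap F K lam : K) : OnePoint K) →
      PGLTwo.frob F K (PGLTwo.frob F K α) ≠ α := by
    intro lam α hlam hα hfr
    by_cases h1 : PGLTwo.frob F K α = α
    · obtain ⟨a, rfl⟩ := (PGLTwo.frob_eq_self_iff F).1 h1
      rw [PGLTwo.value_algebraMap h0 hinv hdeg] at hα
      exact OnePoint.infty_ne_coe _ hα
    · rw [hquad α hfr h1, OnePoint.coe_eq_coe] at hα
      exact hlam ((algebraMap F K).injective hα).symm
  have hex : ∀ (lam : F) (α : K), lam ≠ mu →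
      PGLTwo.value Φ α = ((algebraMap F K lam : K) : OnePoint K) →
      ∃ s : PGL(2, F), s • (α : OnePoint K) = (PGLTwo.frob F K α : OnePoint K) :=
    fun lam α hlam hα ↦ PGLTwo.exists_smul_eq_of_value_eq hinv hnum hdenom
      (hreg lam α hlam hα) hα <| by
      rw [PGLTwo.value_frob hα, AlgHom.commutes]
  refine ⟨mu, hz.symm, fun lam hlam ↦ ⟨PGLTwo.exists_value_eq hnum hdenom _, fun α hα ↦ ?_, ?_⟩,
    fun t ht ↦ ?_⟩
  · refine ⟨PGLTwo.inRegularOrbit (hreg lam α hlam hα), ?_⟩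
    obtain ⟨s, hs⟩ := hex lam α hlam hα
    rw [PGLTwo.frob_apply] at hs
    exact ⟨s, hs, fun t ht ↦ PGLTwo.smul_injective (hreg lam α hlam hα) (ht.trans hs.symm)⟩
  · obtain ⟨α, hα⟩ := PGLTwo.exists_value_eq hnum hdenom (algebraMap F K lam)
    obtain ⟨s, hs⟩ := hex lam α hlam hα
    refine ⟨ConjClasses.mk s, ⟨α, s, hα, by rw [hs, PGLTwo.frob_apply], rfl⟩, ?_⟩
    rintro _ ⟨β, t, hβ, ht, rfl⟩
    rw [← PGLTwo.frob_apply] at ht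
    obtain ⟨r, hr⟩ := PGLTwo.exists_smul_eq_of_value_eq hinv hnum hdenom
      (hreg lam α hlam hα) hα hβ
    rw [ConjClasses.mk_eq_mk_iff_isConj, isConj_comm, isConj_iff]
    -- Both r s r⁻¹ and t send β to β^q, and β has trivial stabilizer.
    refine ⟨r, PGLTwo.smul_injective (hreg lam β hlam hβ) ?_⟩
    simp only
    rw [ht, mul_smul, mul_smul, inv_smul_eq_iff.2 hr.symm, hs, PGLTwo.smul_frob hr]
  · obtain ⟨α, hα, hs⟩ := PGLTwo.exists_smul_eq_frob (K := K) (t := t) fun h ↦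
      ht.not_ge (orderOf_le_of_pow_eq_one two_pos (by rw [sq, h]))
    obtain ⟨w, hw⟩ := OnePoint.ne_infty_iff_exists.1 (PGLTwo.value_ne_infty hinv hnum hdenom hα)
    obtain ⟨lam, rfl⟩ : w ∈ Set.range (algebraMap F K) := by
      rw [← PGLTwo.frob_eq_self_iff]
      refine OnePoint.coe_injective ?_
      rw [← PGLTwo.value_frob hw.symm, PGLTwo.value_smul h0 hinv hs, hw]
    refine ⟨lam, ⟨?_, α, t, hw.symm, by rw [hs, PGLTwo.frob_apply], rfl⟩, ?_⟩
    -- Otherwise γ would share a fibre, hence an orbit, with the regular point α.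
    · rintro rfl
      obtain ⟨r, hr⟩ := PGLTwo.exists_smul_eq_of_value_eq hinv hnum hdenom hα hw.symm hz.symm
      exact PGLTwo.frob_frob_ne_of_smul hα hr hγ
    · rintro lam' ⟨hlam', β, s, hβ, hsβ, hst⟩
      rw [ConjClasses.mk_eq_mk_iff_isConj, isConj_iff] at hst
      obtain ⟨r, hr⟩ := hst
      rw [← PGLTwo.frob_apply] at hsβ
      have hβ' := hreg lam' β hlam' hβ
      -- Moving β by the conjugating element makes t itself send the new point to its Frobenius
      -- conjugate.
      obtain ⟨β', hrβ⟩ := PGLTwo.exists_smul_eq_coe hβ' r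
      have hβ'' := PGLTwo.frob_frob_ne_of_smul hβ' hrβ
      have ht' : t • (β' : OnePoint K) = (PGLTwo.frob F K β' : OnePoint K) := by
        rw [← hr, mul_smul, mul_smul, inv_smul_eq_iff.2 hrβ.symm, hsβ, PGLTwo.smul_frob hrβ]
      obtain ⟨u, hu⟩ := PGLTwo.exists_smul_eq_of_smul_eq_frob (fun h ↦ hα (by rw [h, h]))
        (fun h ↦ hβ'' (by rw [h, h])) hs ht'
      have e := PGLTwo.value_smul h0 hinv hu
      rw [PGLTwo.value_smul h0 hinv hrβ, hβ, ← hw, OnePoint.coe_eq_coe] at e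
      exact (algebraMap F K).injective e
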